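/- A gauge function is a nondecreasing, right-continuous function $g:[0,\infty)\to[0,\infty)$; for such $g$ and $S\subset\mathbb{R}$ put $$\mathcal{H}^g(S)=\lim_{\delta\to 0+}\ \inf\Big\{\sum_{i=1}^\infty g(\operatorname{diam} U_i)\,:\, S\subset\bigcup_{i=1}^\infty U_i \text{ and } \operatorname{diam} U_i<\delta \text{ for all } i\Big\},$$ where $\operatorname{diam}\emptyset=0$. Theorem. Let $A,B\subset\mathbb{R}$ be Borel (respectively, analytic) sets of Lebesgue measure zero, and assume that $B$ is of the second category in $\mathbb{R}$, i.e. not a countable union of nowhere dense sets. Then there are Borel (respectively, analytic) sets $B_1,B_2,A_1,A_2$ with $B=B_1\cup B_2$, $B_1\cap B_2=\emptyset$, $A=A_1\cup A_2$, $A_1\cap A_2=\emptyset$, and gauge functions $g_1,g_2$, such that $$\mathcal{H}^{g_1}(B_1)=1,\quad \mathcal{H}^{g_1}(A_1)=0,\quad \mathcal{H}^{g_2}(B_2)=1,\quad \mathcal{H}^{g_2}(A_2)=0.$$ -/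

import Mathlib

open MeasureTheory Set Filter Topology
open scoped NNReal ENNReal

/-- A gauge function: a nondecreasing, right continuous function `[0,∞) → [0,∞)`. -/
structure IsGauge (g : ℝ≥0 → ℝ≥0) : Prop where
  mono : Monotone g
  rightCts : ∀ x : ℝ≥0, ContinuousWithinAt g (Ici x) x

/-- The size-`δ` Hausdorff premeasure: the infimum of `∑ g (diam U i)` over all countable covers
`(U i)` of `A` by sets of diameter `< δ`. (A set of finite extended diameter is bounded and
`toNNReal` is then its diameter; the empty set has diameter `0`.) -/
noncomputable def gaugePre (g : ℝ≥0 → ℝ≥0) (δ : ℝ≥0∞) (A : Set ℝ) : ℝ≥0∞ :=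
  ⨅ (U : ℕ → Set ℝ) (_ : A ⊆ ⋃ i, U i) (_ : ∀ i, Metric.ediam (U i) < δ),
    ∑' i, (g (Metric.ediam (U i)).toNNReal : ℝ≥0∞)

/-- The Hausdorff measure with gauge function `g`. As the premeasure increases when `δ` decreases,
the limit as `δ → 0+` is the supremum over `δ > 0` (see `tendsto_gaugePre`). -/
noncomputable def gaugeHausdorff (g : ℝ≥0 → ℝ≥0) (A : Set ℝ) : ℝ≥0∞ :=
  ⨆ (δ : ℝ≥0∞) (_ : 0 < δ), gaugePre g δ A

theorem gaugePre_anti (g : ℝ≥0 → ℝ≥0) (A : Set ℝ) {δ δ' : ℝ≥0∞} (h : δ ≤ δ') :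
    gaugePre g δ' A ≤ gaugePre g δ A :=
  le_iInf fun U => le_iInf fun hA => le_iInf fun hU =>
    iInf_le_of_le U <| iInf_le_of_le hA <| iInf_le_of_le (fun i => (hU i).trans_le h) le_rfl

theorem tendsto_gaugePre (g : ℝ≥0 → ℝ≥0) (A : Set ℝ) :
    Tendsto (fun δ : ℝ≥0∞ => gaugePre g δ A) (𝓝[>] 0) (𝓝 (gaugeHausdorff g A)) := by
  rw [← tendsto_comp_coe_Ioi_atBot]
  simp only [gaugeHausdorff, iSup_subtype']
  exact tendsto_atBot_iSup fun r r' hr => gaugePre_anti g A hr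

/-! Put `N = A ∪ B`. Being Lebesgue null, `N` lies in the upper limit of closed sets `E i` of
diameter at most `ρ i`, with `∑ ρ i` finite. Being analytic and nonmeagre, `B` is comeagre in some
interval. It therefore contains Cantor sets built by alternating two operations: from level `a j` to
`b j` one dyadic subinterval is kept, chosen inside a dense open set; from `b j` to the next `a` all
are kept. Over the second range of scales the natural gauge is at most linear, so its values at the
`ρ i` are summable there.

Two such Cantor sets `K₁`, `K₂` use the even and odd terms of one sequence `a 0 < b 0 < a 1 < ...`,
growing fast relative to `ρ`. All but finitely many indices `i` then belong to a block where `g₁` or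
`g₂` is under control. If `L` is the upper limit of the `E i` over the blocks of `g₁`, a
Borel–Cantelli argument makes `N ∩ L` null for `g₁` and `N \ L` null for `g₂`. Thus `L` splits `A`,
and it splits `B` once `K₁` and `K₂` are assigned to their own sides.

The main ingredients are `AnalyticSet.exists_isMeagre_diff`, `edist_le_cantorGauge` and
`tsum_alternateBlocks_ne_top`. -/

/-! ### Elementary properties of gauge measures. -/

theorem gaugePre_mono (g : ℝ≥0 → ℝ≥0) (δ : ℝ≥0∞) {S T : Set ℝ} (h : S ⊆ T) :
    gaugePre g δ S ≤ gaugePre g δ T :=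
  le_iInf fun U => le_iInf fun hT => le_iInf fun hU =>
    iInf_le_of_le U <| iInf_le_of_le (h.trans hT) <| iInf_le_of_le hU le_rfl

theorem gaugeHausdorff_mono (g : ℝ≥0 → ℝ≥0) {S T : Set ℝ} (h : S ⊆ T) :
    gaugeHausdorff g S ≤ gaugeHausdorff g T :=
  iSup₂_mono fun δ _ => gaugePre_mono g δ h

theorem gaugePre_le_tsum {g : ℝ≥0 → ℝ≥0} {δ : ℝ≥0∞} {S : Set ℝ} (U : ℕ → Set ℝ)
    (hS : S ⊆ ⋃ i, U i) (hU : ∀ i, Metric.ediam (U i) < δ) :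
    gaugePre g δ S ≤ ∑' i, (g (Metric.ediam (U i)).toNNReal : ℝ≥0∞) :=
  iInf_le_of_le U <| iInf_le_of_le hS <| iInf_le_of_le hU le_rfl

theorem gaugePre_union_le (g : ℝ≥0 → ℝ≥0) (δ : ℝ≥0∞) (S T : Set ℝ) :
    gaugePre g δ (S ∪ T) ≤ gaugePre g δ S + gaugePre g δ T := by
  refine ENNReal.le_iInf_add_iInf fun U V => ENNReal.le_iInf_add_iInf fun hS hT =>
    ENNReal.le_iInf_add_iInf fun hU hV => ?_
  let W : ℕ → Set ℝ := fun n => if n % 2 = 0 then U (n / 2) else V (n / 2)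
  have hWe : ∀ i, W (2 * i) = U i := fun i => by simp [W]
  have hWo : ∀ i, W (2 * i + 1) = V i := fun i => by
    have h1 : (2 * i + 1) % 2 = 1 := by omega
    have h2 : (2 * i + 1) / 2 = i := by omega
    simp [W, h1, h2]
  have hW : ∀ i, Metric.ediam (W i) < δ := fun i => by
    simp only [W]
    split_ifs
    exacts [hU _, hV _]
  refine (gaugePre_le_tsum W ?_ hW).trans_eq ?_
  · rintro x (hx | hx)
    · obtain ⟨i, hi⟩ := mem_iUnion.1 (hS hx)
      exact mem_iUnion.2 ⟨2 * i, by rwa [hWe]⟩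
    · obtain ⟨i, hi⟩ := mem_iUnion.1 (hT hx)
      exact mem_iUnion.2 ⟨2 * i + 1, by rwa [hWo]⟩
  · rw [← tsum_even_add_odd ENNReal.summable ENNReal.summable]
    simp only [hWe, hWo]

theorem gaugeHausdorff_union_le (g : ℝ≥0 → ℝ≥0) (S T : Set ℝ) :
    gaugeHausdorff g (S ∪ T) ≤ gaugeHausdorff g S + gaugeHausdorff g T :=
  iSup₂_le fun δ hδ => (gaugePre_union_le g δ S T).trans <|
    add_le_add (le_iSup₂_of_le δ hδ le_rfl) (le_iSup₂_of_le δ hδ le_rfl)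

theorem gaugeHausdorff_union_null {g : ℝ≥0 → ℝ≥0} (S : Set ℝ) {T : Set ℝ}
    (hT : gaugeHausdorff g T = 0) : gaugeHausdorff g (S ∪ T) = gaugeHausdorff g S :=
  le_antisymm ((gaugeHausdorff_union_le g S T).trans (by rw [hT, add_zero]))
    (gaugeHausdorff_mono g subset_union_left)

theorem gaugePre_const_mul (g : ℝ≥0 → ℝ≥0) {c : ℝ≥0} (hc : c ≠ 0) (δ : ℝ≥0∞) (S : Set ℝ) :
    gaugePre (fun r => c * g r) δ S = c * gaugePre g δ S := by
  have h0 : (c : ℝ≥0∞) ≠ 0 := by simpa using hc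
  simp only [gaugePre, ENNReal.coe_mul, ENNReal.tsum_mul_left,
    ENNReal.mul_iInf_of_ne h0 ENNReal.coe_ne_top]

theorem gaugeHausdorff_const_mul (g : ℝ≥0 → ℝ≥0) {c : ℝ≥0} (hc : c ≠ 0) (S : Set ℝ) :
    gaugeHausdorff (fun r => c * g r) S = c * gaugeHausdorff g S := by
  simp only [gaugeHausdorff, gaugePre_const_mul g hc, ENNReal.mul_iSup]

theorem IsGauge.const_mul {g : ℝ≥0 → ℝ≥0} (hg : IsGauge g) (c : ℝ≥0) :
    IsGauge fun r => c * g r where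
  mono _ _ h := mul_le_mul_right (hg.mono h) c
  rightCts x := continuousWithinAt_const.mul (hg.rightCts x)

/-! ### Null sets as upper limits of small sets. -/

/-- A set whose points lie in infinitely many members of a sequence of sets with summable
gauge is null. -/
theorem gaugeHausdorff_eq_zero_of_frequently {g : ℝ≥0 → ℝ≥0} (hg : Monotone g) (hg0 : g 0 = 0)
    {E : ℕ → Set ℝ} {ρ : ℕ → ℝ≥0} (hE : ∀ n, Metric.ediam (E n) ≤ ρ n)
    (hρ : Tendsto ρ atTop (𝓝 0)) {s : Set ℕ}
    (hs : ∑' n, s.indicator (fun n => (g (ρ n) : ℝ≥0∞)) n ≠ ∞) {L : Set ℝ}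
    (hL : ∀ x ∈ L, ∃ᶠ n in atTop, n ∈ s ∧ x ∈ E n) : gaugeHausdorff g L = 0 := by
  classical
  rw [← nonpos_iff_eq_zero]
  refine iSup₂_le fun δ hδ => ?_
  have htail := ENNReal.tendsto_sum_nat_add _ hs
  refine ge_of_tendsto htail ?_
  have hsmall : ∀ᶠ n in atTop, (ρ n : ℝ≥0∞) < δ :=
    (ENNReal.tendsto_coe.2 hρ).eventually_lt_const (by simpa using hδ)
  obtain ⟨m₀, hm₀⟩ := eventually_atTop.1 hsmall
  filter_upwards [eventually_ge_atTop m₀] with m hm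
  -- Indices outside `s` are padded with the empty set, which costs nothing as `g 0 = 0`.
  let U : ℕ → Set ℝ := fun i => if i + m ∈ s then E (i + m) else ∅
  have hU : ∀ i, Metric.ediam (U i) < δ := by
    intro i
    by_cases h : i + m ∈ s
    · simp only [U, h, if_true]
      exact (hE _).trans_lt (hm₀ _ (by omega))
    · simpa [U, h] using hδ
  refine (gaugePre_le_tsum U ?_ hU).trans (ENNReal.tsum_le_tsum fun i => ?_)
  · intro x hx
    obtain ⟨n, hn, hns, hxn⟩ := frequently_atTop.1 (hL x hx) m
    refine mem_iUnion.2 ⟨n - m, ?_⟩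
    simp [U, Nat.sub_add_cancel hn, hns, hxn]
  · by_cases h : i + m ∈ s
    · simp only [U, h, if_true, indicator_of_mem]
      exact_mod_cast hg ((ENNReal.toNNReal_mono ENNReal.coe_ne_top (hE _)).trans_eq
        (ENNReal.toNNReal_coe _))
    · simp [U, h, hg0]

theorem exists_cover_of_volume_eq_zero {N : Set ℝ} (hN : volume N = 0) {ε : ℝ≥0∞} (hε : 0 < ε) :
    ∃ t : ℕ → Set ℝ, N ⊆ ⋃ n, t n ∧ ∑' n, Metric.ediam (t n) < ε := by
  rw [← hausdorffMeasure_real, Measure.hausdorffMeasure_apply] at hN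
  have h1 := (le_iSup₂ (f := fun (r : ℝ≥0∞) (_ : 0 < r) =>
    ⨅ (t : ℕ → Set ℝ) (_ : N ⊆ ⋃ n, t n) (_ : ∀ n, Metric.ediam (t n) ≤ r),
          ∑' n, ⨆ _ : (t n).Nonempty, Metric.ediam (t n) ^ (1 : ℝ)) 1 one_pos).trans_eq hN
  have h2 := h1.trans_lt hε
  simp only [iInf_lt_iff] at h2
  obtain ⟨t, ht, -, hlt⟩ := h2
  refine ⟨t, ht, lt_of_le_of_lt (ENNReal.tsum_le_tsum fun n => ?_) hlt⟩
  rcases (t n).eq_empty_or_nonempty with h | h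
  · simp [h]
  · simp [h]

/-- A Lebesgue null set lies in the upper limit of a sequence of closed sets with summable
diameters. -/
theorem exists_frequently_mem_of_volume_eq_zero {N : Set ℝ} (hN : volume N = 0) :
    ∃ (E : ℕ → Set ℝ) (ρ : ℕ → ℝ≥0), (∀ n, IsClosed (E n)) ∧ (∀ n, 0 < ρ n) ∧ Summable ρ ∧
      (∀ n, Metric.ediam (E n) ≤ ρ n) ∧ ∀ x ∈ N, ∃ᶠ n in atTop, x ∈ E n := by
  obtain ⟨ε, hε0, hε⟩ := ENNReal.exists_pos_sum_of_countable' (ε := 1) one_ne_zero ℕ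
  choose t htN ht using fun j => exists_cover_of_volume_eq_zero hN (hε0 j)
  -- The `η n` make every `ρ n` positive, so that some dyadic scale lies below it.
  obtain ⟨η, hη0, hη⟩ := ENNReal.exists_pos_sum_of_countable (ε := 1) one_ne_zero ℕ
  have hsum : ∑' n : ℕ, (Metric.ediam (t n.unpair.1 n.unpair.2) + η n) < ∞ := by
    rw [ENNReal.tsum_add]
    refine ENNReal.add_lt_top.2 ⟨?_, hη.trans ENNReal.one_lt_top⟩
    have := Nat.pairEquiv.symm.tsum_eq (fun p : ℕ × ℕ => Metric.ediam (t p.1 p.2))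
    simp only [Nat.pairEquiv_symm_apply] at this
    rw [this, ENNReal.tsum_prod']
    exact (ENNReal.tsum_le_tsum fun j => (ht j).le).trans_lt (hε.trans ENNReal.one_lt_top)
  have hfin : ∀ n : ℕ, Metric.ediam (t n.unpair.1 n.unpair.2) + η n ≠ ∞ :=
    ENNReal.ne_top_of_tsum_ne_top hsum.ne
  refine ⟨fun n => closure (t n.unpair.1 n.unpair.2),
    fun n => (Metric.ediam (t n.unpair.1 n.unpair.2) + η n).toNNReal,
    fun n => isClosed_closure, fun n => ?_, ?_, fun n => ?_, fun x hx => ?_⟩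
  · exact ENNReal.toNNReal_pos (by simp [(hη0 n).ne']) (hfin n)
  · exact ENNReal.summable_toNNReal_of_tsum_ne_top hsum.ne
  · rw [ENNReal.coe_toNNReal (hfin n), Metric.ediam_closure]
    exact le_self_add
  · refine frequently_atTop.2 fun m => ?_
    obtain ⟨i, hi⟩ := mem_iUnion.1 (htN m hx)
    -- All indices of the `m`-th cover are at least `m`.
    exact ⟨Nat.pair m i, Nat.left_le_pair m i, by simpa using subset_closure hi⟩

/-! ### Category: analytic sets and the Baire property. -/

/-- The points at which `S` is locally of the second category. -/
def nonmeagreAt {X : Type*} [TopologicalSpace X] (S : Set X) : Set X :=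
  {x | ∀ V ∈ 𝓝 x, ¬ IsMeagre (S ∩ V)}

section
variable {X : Type*} [TopologicalSpace X]

theorem isClosed_nonmeagreAt (S : Set X) : IsClosed (nonmeagreAt S) := by
  rw [← isOpen_compl_iff, isOpen_iff_mem_nhds]
  intro x hx
  simp only [nonmeagreAt, mem_compl_iff, mem_ofPred_eq, not_forall, not_not] at hx
  obtain ⟨V, hV, hSV⟩ := hx
  filter_upwards [eventually_mem_nhds_iff.2 hV] with y hy hyS using hyS V hy hSV

theorem nonmeagreAt_subset_closure (S : Set X) : nonmeagreAt S ⊆ closure S := by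
  intro x hx
  rw [mem_closure_iff_nhds]
  intro V hV
  by_contra h
  rw [not_nonempty_iff_eq_empty] at h
  exact hx V hV (by rw [inter_comm, h]; exact IsMeagre.empty)

theorem isMeagre_diff_nonmeagreAt [SecondCountableTopology X] (S : Set X) :
    IsMeagre (S \ nonmeagreAt S) := by
  have hb := TopologicalSpace.isBasis_countableBasis X
  have hc : {V ∈ TopologicalSpace.countableBasis X | IsMeagre (S ∩ V)}.Countable :=
    (TopologicalSpace.countable_countableBasis X).mono fun V hV => hV.1
  refine IsMeagre.mono ?_ (isMeagre_biUnion hc (f := fun V => S ∩ V) fun V hV => hV.2)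
  rintro x ⟨hxS, hx⟩
  simp only [nonmeagreAt, mem_ofPred_eq, not_forall, not_not] at hx
  obtain ⟨V, hV, hSV⟩ := hx
  obtain ⟨W, hW, hxW, hWV⟩ := hb.mem_nhds_iff.1 hV
  exact mem_biUnion ⟨hW, hSV.mono (inter_subset_inter_right S hWV)⟩ ⟨hxS, hxW⟩

theorem isMeagre_diff_interior_nonmeagreAt [SecondCountableTopology X] (S : Set X) :
    IsMeagre (S \ interior (nonmeagreAt S)) := by
  have h : IsMeagre (frontier (nonmeagreAt S)) :=
    ((isClosed_frontier.isNowhereDense_iff).2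
      (interior_frontier (isClosed_nonmeagreAt S))).isMeagre
  refine IsMeagre.mono ?_ ((isMeagre_diff_nonmeagreAt S).union h)
  rintro x ⟨hxS, hx⟩
  by_cases hD : x ∈ nonmeagreAt S
  · exact Or.inr ⟨subset_closure hD, hx⟩
  · exact Or.inl ⟨hxS, hD⟩

/-- Off the closure of `G` every `S i` is meagre, hence so is the union; the difference is thus
confined to the frontier of the open set `G`. -/
theorem isMeagre_interior_nonmeagreAt_iUnion_diff [SecondCountableTopology X] {ι : Type*}
    [Countable ι] (S : ι → Set X) :
    IsMeagre (interior (nonmeagreAt (⋃ i, S i)) \ ⋃ i, interior (nonmeagreAt (S i))) := by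
  set G := ⋃ i, interior (nonmeagreAt (S i)) with hG
  have hGo : IsOpen G := isOpen_iUnion fun i => isOpen_interior
  have h : IsMeagre (frontier G) := by
    refine ((isClosed_frontier.isNowhereDense_iff).2 ?_).isMeagre
    rw [← frontier_compl]
    exact interior_frontier hGo.isClosed_compl
  refine h.mono ?_
  rintro x ⟨hx, hxG⟩
  refine ⟨?_, by rwa [hGo.interior_eq]⟩
  by_contra hcl
  refine interior_subset hx (closure G)ᶜ (isClosed_closure.isOpen_compl.mem_nhds hcl) ?_
  refine IsMeagre.mono ?_
    (isMeagre_iUnion fun i => isMeagre_diff_interior_nonmeagreAt (S i))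
  rintro y ⟨hy, hyG⟩
  obtain ⟨i, hi⟩ := mem_iUnion.1 hy
  exact mem_iUnion.2 ⟨i, hi, fun h' => hyG (subset_closure (mem_iUnion.2 ⟨i, h'⟩))⟩

/-- A nonmeagre analytic set is comeagre in some nonempty open set. -/
theorem MeasureTheory.AnalyticSet.exists_isMeagre_diff [SecondCountableTopology X]
    [T2Space X] {B : Set X} (hB : AnalyticSet B) (hB2 : ¬ IsMeagre B) :
    ∃ V : Set X, IsOpen V ∧ V.Nonempty ∧ IsMeagre (V \ B) := by
  rw [AnalyticSet] at hB
  rcases hB with rfl | ⟨f, hf, rfl⟩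
  · exact absurd IsMeagre.empty hB2
  -- `PiNat.res` lists the latest coordinate first, so `n :: s` extends `s`.
  let F : List ℕ → Set X := fun s => f '' {x | PiNat.res x s.length = s}
  have hF0 : F [] = range f := by simp [F]
  have hF : ∀ s, F s = ⋃ n : ℕ, F (n :: s) := by
    intro s
    ext y
    simp only [F, mem_iUnion, mem_image, mem_ofPred_eq, List.length_cons, PiNat.res_succ,
      List.cons.injEq]
    constructor
    · rintro ⟨x, hx, rfl⟩
      exact ⟨x s.length, x, ⟨rfl, hx⟩, rfl⟩
    · rintro ⟨n, x, ⟨-, hx⟩, rfl⟩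
      exact ⟨x, hx, rfl⟩
  let Z : List ℕ → Set X := fun s =>
    interior (nonmeagreAt (F s)) \ ⋃ n : ℕ, interior (nonmeagreAt (F (n :: s)))
  have hZ : ∀ s, IsMeagre (Z s) := by
    intro s
    have := isMeagre_interior_nonmeagreAt_iUnion_diff fun n : ℕ => F (n :: s)
    rwa [← hF s] at this
  refine ⟨interior (nonmeagreAt (range f)), isOpen_interior, ?_, ?_⟩
  · rw [nonempty_iff_ne_empty]
    intro h
    have := isMeagre_diff_interior_nonmeagreAt (range f)
    rw [h, sdiff_empty] at this
    exact hB2 this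
  refine (isMeagre_iUnion hZ).mono ?_
  rintro x ⟨hx, hxB⟩
  by_contra hxZ
  have hstep : ∀ s, x ∈ interior (nonmeagreAt (F s)) →
      ∃ n : ℕ, x ∈ interior (nonmeagreAt (F (n :: s))) := by
    intro s hs
    by_contra h
    exact hxZ (mem_iUnion.2 ⟨s, hs, by simpa using h⟩)
  choose! nx hnx using hstep
  let s : ℕ → List ℕ := fun k => Nat.rec [] (fun _ l => nx l :: l) k
  have hs : ∀ k, x ∈ interior (nonmeagreAt (F (s k))) := by
    intro k
    induction k with
    | zero => rw [← hF0] at hx; exact hx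
    | succ k ih => exact hnx _ ih
  let α : ℕ → ℕ := fun k => nx (s k)
  have hα : ∀ k, PiNat.res α k = s k := by
    intro k
    induction k with
    | zero => rfl
    | succ k ih => rw [PiNat.res_succ, ih]
  refine hxB ⟨α, ?_⟩
  -- `x` is in the closure of every `F (s k)`, whereas for large `k` continuity puts `F (s k)` in a
  -- neighbourhood of `f α` disjoint from one of `x`.
  by_contra hne
  obtain ⟨P, hP, Q, hQ, hPQ⟩ : ∃ P ∈ 𝓝 (f α), ∃ Q ∈ 𝓝 x, Disjoint P Q :=
    (disjoint_nhds_nhds.2 hne) |> Filter.disjoint_iff.1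
  obtain ⟨W, ⟨β, k, rfl⟩, hαW, hWP⟩ :=
    (PiNat.isTopologicalBasis_cylinders (fun _ : ℕ => ℕ)).mem_nhds_iff.1
      (hf.continuousAt.preimage_mem_nhds hP)
  rw [← PiNat.mem_cylinder_iff_eq.1 hαW] at hWP
  have hcl := nonmeagreAt_subset_closure _ (interior_subset (hs k))
  obtain ⟨y, hyQ, γ, hγ, rfl⟩ := mem_closure_iff_nhds.1 hcl Q hQ
  have hlen : (s k).length = k := by rw [← hα, PiNat.res_length]
  rw [mem_ofPred_eq, hlen, ← hα] at hγ
  have : γ ∈ PiNat.cylinder α k := by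
    rw [PiNat.cylinder_eq_res]; exact hγ
  exact disjoint_left.1 hPQ (hWP this) hyQ

end

/-! ### Dyadic intervals. -/

/-- The closed dyadic interval `[q / 2 ^ a, (q + 1) / 2 ^ a]`. -/
def dyadicCell (a : ℕ) (q : ℤ) : Set ℝ := Icc ((q : ℝ) / 2 ^ a) (((q : ℝ) + 1) / 2 ^ a)

theorem ediam_dyadicCell (a : ℕ) (q : ℤ) :
    Metric.ediam (dyadicCell a q) = (((2 ^ a)⁻¹ : ℝ≥0) : ℝ≥0∞) := by
  have h : ((q : ℝ) + 1) / 2 ^ a - (q : ℝ) / 2 ^ a = (((2 ^ a)⁻¹ : ℝ≥0) : ℝ) := by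
    push_cast
    ring
  rw [dyadicCell, Real.ediam_Icc, h, ENNReal.ofReal_coe_nnreal]

theorem dyadicCell_nonempty (a : ℕ) (q : ℤ) : ((q : ℝ) / 2 ^ a) ∈ dyadicCell a q :=
  left_mem_Icc.2 (by gcongr; linarith)

theorem dyadicCell_subset_iff {a b : ℕ} (hab : a ≤ b) {p q : ℤ} :
    dyadicCell b p ⊆ dyadicCell a q ↔
      q * 2 ^ (b - a) ≤ p ∧ p + 1 ≤ (q + 1) * 2 ^ (b - a) := by
  obtain ⟨c, rfl⟩ := Nat.exists_eq_add_of_le hab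
  have ha : (0 : ℝ) < 2 ^ a := by positivity
  have hc : (0 : ℝ) < 2 ^ c := by positivity
  rw [dyadicCell, dyadicCell, Icc_subset_Icc_iff (by gcongr; linarith), Nat.add_sub_cancel_left,
    pow_add, div_le_div_iff₀ ha (by positivity), div_le_div_iff₀ (by positivity) ha]
  rw [show (q : ℝ) * (2 ^ a * 2 ^ c) = q * 2 ^ c * 2 ^ a by ring,
    show ((q : ℝ) + 1) * (2 ^ a * 2 ^ c) = (q + 1) * 2 ^ c * 2 ^ a by ring,
    mul_le_mul_iff_left₀ ha, mul_le_mul_iff_left₀ ha]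
  norm_cast

theorem exists_dyadicCell_subset {W : Set ℝ} (hW : IsOpen W) (hne : W.Nonempty) :
    ∃ b₀, ∀ b ≥ b₀, ∃ p, dyadicCell b p ⊆ W := by
  obtain ⟨x, hx⟩ := hne
  obtain ⟨ε, hε, hball⟩ := Metric.isOpen_iff.1 hW x hx
  obtain ⟨b₀, hb₀⟩ := exists_pow_lt_of_lt_one hε (y := (1 / 2 : ℝ)) (by norm_num)
  refine ⟨b₀, fun b hb => ⟨⌊x * 2 ^ b⌋, fun y hy => hball ?_⟩⟩
  have h2 : (0 : ℝ) < 2 ^ b := by positivity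
  have hlt : (1 / 2 : ℝ) ^ b < ε :=
    (pow_le_pow_of_le_one (by norm_num) (by norm_num) hb).trans_lt hb₀
  rw [one_div, inv_pow, inv_lt_iff_one_lt_mul₀ h2] at hlt
  obtain ⟨h3, h4⟩ := hy
  rw [div_le_iff₀ h2] at h3
  rw [le_div_iff₀ h2] at h4
  have h5 := Int.floor_le (x * 2 ^ b)
  have h6 := Int.lt_floor_add_one (x * 2 ^ b)
  rw [Metric.mem_ball, Real.dist_eq, abs_lt]
  constructor <;> nlinarith

/-- Every dyadic interval of level `a` in `[u, v]` contains one of a common level `b` inside a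
given dense open set. -/
theorem exists_level_dyadicCell_subset {O : Set ℝ} (hO : IsOpen O) (hd : Dense O) (u v : ℝ)
    (a : ℕ) : ∃ b > a, ∀ q : ℤ, ∃ p : ℤ, dyadicCell b p ⊆ dyadicCell a q ∧
      (dyadicCell a q ⊆ Icc u v → dyadicCell b p ⊆ O) := by
  have h2 : (0 : ℝ) < 2 ^ a := by positivity
  have key : ∀ q : ℤ, ∃ b₀, ∀ b ≥ b₀, ∃ p, dyadicCell b p ⊆ dyadicCell a q ∩ O := by
    intro q
    have hlt : (q : ℝ) / 2 ^ a < (q + 1) / 2 ^ a := by gcongr; linarith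
    obtain ⟨b₀, hb₀⟩ := exists_dyadicCell_subset (isOpen_Ioo.inter hO)
      (hd.inter_open_nonempty _ isOpen_Ioo (nonempty_Ioo.2 hlt))
    refine ⟨b₀, fun b hb => ?_⟩
    obtain ⟨p, hp⟩ := hb₀ b hb
    exact ⟨p, hp.trans (inter_subset_inter_left _ Ioo_subset_Icc_self)⟩
  choose β hβ using key
  -- Only finitely many cells of level `a` lie in `[u, v]`, so one level serves them all.
  let s : Finset ℤ := Finset.Icc ⌊u * 2 ^ a⌋ ⌈v * 2 ^ a⌉
  refine ⟨max (s.sup β) (a + 1), by simp, fun q => ?_⟩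
  by_cases hq : dyadicCell a q ⊆ Icc u v
  · have hqs : q ∈ s := by
      obtain ⟨h3, h4⟩ := hq (dyadicCell_nonempty a q)
      rw [le_div_iff₀ h2] at h3
      rw [div_le_iff₀ h2] at h4
      refine Finset.mem_Icc.2 ⟨?_, ?_⟩
      · exact_mod_cast (Int.floor_le _).trans h3
      · exact_mod_cast h4.trans (Int.le_ceil _)
    obtain ⟨p, hp⟩ := hβ q _ ((Finset.le_sup hqs).trans (le_max_left _ (a + 1)))
    exact ⟨p, hp.trans inter_subset_left, fun _ => hp.trans inter_subset_right⟩
  · have hle : a ≤ max (s.sup β) (a + 1) := le_max_of_le_right (Nat.le_succ a)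
    -- The remaining cells get their leftmost subcell, making the choice total on `ℤ`.
    refine ⟨q * 2 ^ (max (s.sup β) (a + 1) - a), ?_, fun h => absurd h hq⟩
    rw [dyadicCell_subset_iff hle]
    have : (0 : ℤ) < 2 ^ (max (s.sup β) (a + 1) - a) := by positivity
    constructor <;> nlinarith

/-! ### Cantor sets and their gauges. -/

section Cantor

/-- The number of binary digits that are copied before level `a j`. -/
def copiedDigits (a b : ℕ → ℕ) (j : ℕ) : ℕ := ∑ i ∈ Finset.range j, (a (i + 1) - b i)

/-- The gauge adapted to the level sequences `a` and `b`: the infimum of the affine functions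
`r ↦ 2 ^ (-M j) * (2 + r * 2 ^ a j)`, where `M = copiedDigits a b`. -/
noncomputable def cantorGauge (a b : ℕ → ℕ) (r : ℝ≥0) : ℝ≥0 :=
  ⨅ j, (2 ^ copiedDigits a b j)⁻¹ * (2 + r * 2 ^ a j)

/-- The level `a j` index of the dyadic interval reached from the integer part `X` of
`x * 2 ^ copiedDigits a b j`, where `P i q` is the level `b i` index of the interval chosen inside
the level `a i` interval of index `q`. -/
def cantorIndex (a b : ℕ → ℕ) (P : ℕ → ℤ → ℤ) (Q : ℤ) : ℕ → ℤ → ℤ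
  | 0, X => Q + X
  | j + 1, X => P j (cantorIndex a b P Q j (X / 2 ^ (a (j + 1) - b j))) * 2 ^ (a (j + 1) - b j) +
      X % 2 ^ (a (j + 1) - b j)

/-- The parametrization of the Cantor set by the real line. -/
noncomputable def cantorMap (a b : ℕ → ℕ) (P : ℕ → ℤ → ℤ) (Q : ℤ) (x : ℝ) : ℝ :=
  ⨆ j, (cantorIndex a b P Q j ⌊x * 2 ^ copiedDigits a b j⌋ : ℝ) / 2 ^ a j

variable {a b : ℕ → ℕ} {P : ℕ → ℤ → ℤ} {Q : ℤ}

theorem copiedDigits_succ (j : ℕ) :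
    copiedDigits a b (j + 1) = copiedDigits a b j + (a (j + 1) - b j) :=
  Finset.sum_range_succ _ _

theorem le_copiedDigits (hba : ∀ j, b j < a (j + 1)) (j : ℕ) : j ≤ copiedDigits a b j := by
  induction j with
  | zero => exact Nat.zero_le _
  | succ j ih =>
    rw [copiedDigits_succ]
    have := hba j
    omega

theorem cantorGauge_le (j : ℕ) (r : ℝ≥0) :
    cantorGauge a b r ≤ (2 ^ copiedDigits a b j)⁻¹ * (2 + r * 2 ^ a j) :=
  ciInf_le (OrderBot.bddBelow _) j

/-- An infimum of continuous functions is upper semicontinuous; monotonicity supplies the other half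
of right continuity. -/
theorem isGauge_cantorGauge (a b : ℕ → ℕ) : IsGauge (cantorGauge a b) := by
  have hmono : Monotone (cantorGauge a b) := fun r s h =>
    le_ciInf fun j => (cantorGauge_le j r).trans (by gcongr)
  refine ⟨hmono, fun x => ?_⟩
  refine tendsto_order.2 ⟨fun c hc => ?_, fun c hc => ?_⟩
  · filter_upwards [self_mem_nhdsWithin] with y hy using hc.trans_le (hmono hy)
  · obtain ⟨j, hj⟩ := exists_lt_of_ciInf_lt hc
    have hcont : Continuous fun r : ℝ≥0 => (2 ^ copiedDigits a b j)⁻¹ * (2 + r * 2 ^ a j) := by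
      fun_prop
    filter_upwards [nhdsWithin_le_nhds ((hcont.tendsto x).eventually_lt_const hj)] with y hy
      using (cantorGauge_le j y).trans_lt hy

theorem cantorGauge_zero (hba : ∀ j, b j < a (j + 1)) : cantorGauge a b 0 = 0 := by
  rw [← nonpos_iff_eq_zero]
  have ht : Tendsto (fun j : ℕ => ((1 / 2 : ℝ≥0) ^ j) * 2) atTop (𝓝 (0 * 2)) :=
    (tendsto_pow_atTop_nhds_zero_of_lt_one (by norm_num) (NNReal.half_lt_self one_ne_zero)).mul_const _
  rw [zero_mul] at ht
  refine ge_of_tendsto' ht fun j => (cantorGauge_le j 0).trans ?_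
  rw [zero_mul, add_zero, one_div, inv_pow]
  gcongr
  · norm_num
  · exact le_copiedDigits hba j

/-- The affine function of index `j + 1` has slope `2 ^ (b j - M j)`, and in this range its constant
term is absorbed at the price of a factor 3. -/
theorem cantorGauge_le_linear (hba : ∀ j, b j < a (j + 1)) (j : ℕ) {r : ℝ≥0}
    (hr : (2 ^ a (j + 1))⁻¹ ≤ r) : cantorGauge a b r ≤ 3 * r * 2 ^ b j := by
  obtain ⟨m, hm⟩ := Nat.exists_eq_add_of_le (hba j).le
  have h1 : 1 ≤ r * 2 ^ a (j + 1) := by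
    rwa [inv_le_iff_one_le_mul₀ (by positivity)] at hr
  calc cantorGauge a b r ≤ _ := cantorGauge_le (j + 1) r
    _ ≤ (2 ^ copiedDigits a b (j + 1))⁻¹ * (3 * (r * 2 ^ a (j + 1))) := by
        gcongr
        calc 2 + r * 2 ^ a (j + 1) ≤ 2 * (r * 2 ^ a (j + 1)) + r * 2 ^ a (j + 1) := by
              gcongr
              simpa using mul_le_mul_right h1 2
          _ = _ := by ring
    _ = (2 ^ copiedDigits a b j)⁻¹ * (3 * r * 2 ^ b j) := by
        rw [copiedDigits_succ, hm, Nat.add_sub_cancel_left, pow_add, pow_add]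
        field_simp
    _ ≤ 1 * (3 * r * 2 ^ b j) := by
        gcongr
        exact inv_le_one_of_one_le₀ (one_le_pow₀ (by norm_num))
    _ = _ := one_mul _

/-- Under the same parent the copied digits decide; under different parents the chosen cells lie in
nonoverlapping cells, already in the right order. -/
theorem strictMono_cantorIndex (hab : ∀ j, a j < b j)
    (hP : ∀ j q, dyadicCell (b j) (P j q) ⊆ dyadicCell (a j) q) (j : ℕ) :
    StrictMono (cantorIndex a b P Q j) := by
  induction j with
  | zero => exact fun X Y h => by simpa [cantorIndex] using h
  | succ j ih =>
    intro X Y hXY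
    simp only [cantorIndex]
    set m : ℤ := 2 ^ (a (j + 1) - b j) with hm
    have hm0 : 0 < m := by positivity
    have hX := Int.emod_lt_of_pos X hm0
    have hY := Int.emod_nonneg Y hm0.ne'
    rcases (Int.ediv_le_ediv hm0 hXY.le).eq_or_lt with h | h
    · rw [h]
      have h1 := Int.mul_ediv_add_emod X m
      have h2 := Int.mul_ediv_add_emod Y m
      rw [h] at h1
      linarith
    · have h1 := ((dyadicCell_subset_iff (hab j).le).1
        (hP j (cantorIndex a b P Q j (X / m)))).2
      have h2 := ((dyadicCell_subset_iff (hab j).le).1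
        (hP j (cantorIndex a b P Q j (Y / m)))).1
      have h3 : (cantorIndex a b P Q j (X / m) + 1) * 2 ^ (b j - a j) ≤
          cantorIndex a b P Q j (Y / m) * 2 ^ (b j - a j) := by
        gcongr
        exact ih h
      have h4 : P j (cantorIndex a b P Q j (X / m)) + 1 ≤
        P j (cantorIndex a b P Q j (Y / m)) := h1.trans (h3.trans h2)
      nlinarith

theorem sub_le_cantorIndex_sub (hab : ∀ j, a j < b j)
    (hP : ∀ j q, dyadicCell (b j) (P j q) ⊆ dyadicCell (a j) q) (j : ℕ) {X Y : ℤ} (h : X ≤ Y) :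
    Y - X ≤ cantorIndex a b P Q j Y - cantorIndex a b P Q j X := by
  induction Y, h using Int.leInduction with
  | base => simp
  | succ Y _ ih =>
    have := strictMono_cantorIndex (Q := Q) hab hP j (lt_add_one Y)
    omega

theorem floor_mul_pow_ediv (x : ℝ) (M m : ℕ) :
    ⌊x * 2 ^ (M + m)⌋ / 2 ^ m = ⌊x * 2 ^ M⌋ := by
  have h := Int.floor_div_natCast (x * 2 ^ (M + m)) (2 ^ m)
  push_cast at h
  rw [← h, pow_add]
  congr 1
  field_simp

theorem cantorIndex_succ_subset (hba : ∀ j, b j < a (j + 1)) (j : ℕ) (x : ℝ) :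
    dyadicCell (a (j + 1)) (cantorIndex a b P Q (j + 1) ⌊x * 2 ^ copiedDigits a b (j + 1)⌋) ⊆
      dyadicCell (b j) (P j (cantorIndex a b P Q j ⌊x * 2 ^ copiedDigits a b j⌋)) := by
  rw [dyadicCell_subset_iff (hba j).le]
  simp only [cantorIndex]
  rw [copiedDigits_succ, floor_mul_pow_ediv]
  set m : ℤ := 2 ^ (a (j + 1) - b j) with hm
  have hm0 : 0 < m := by positivity
  have h1 := Int.emod_lt_of_pos ⌊x * 2 ^ (copiedDigits a b j + (a (j + 1) - b j))⌋ hm0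
  have h2 := Int.emod_nonneg ⌊x * 2 ^ (copiedDigits a b j + (a (j + 1) - b j))⌋ hm0.ne'
  constructor <;> linarith

theorem antitone_cantorCell (hba : ∀ j, b j < a (j + 1))
    (hP : ∀ j q, dyadicCell (b j) (P j q) ⊆ dyadicCell (a j) q) (x : ℝ) :
    Antitone fun j => dyadicCell (a j) (cantorIndex a b P Q j ⌊x * 2 ^ copiedDigits a b j⌋) :=
  antitone_nat_of_succ_le fun j => (cantorIndex_succ_subset hba j x).trans (hP j _)

theorem cantorMap_mem (hba : ∀ j, b j < a (j + 1))
    (hP : ∀ j q, dyadicCell (b j) (P j q) ⊆ dyadicCell (a j) q) (x : ℝ) (j : ℕ) :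
    cantorMap a b P Q x ∈
      dyadicCell (a j) (cantorIndex a b P Q j ⌊x * 2 ^ copiedDigits a b j⌋) := by
  have h := ciSup_mem_iInter_Icc_of_antitone_Icc (antitone_cantorCell (Q := Q) hba hP x)
    (fun j => by gcongr; linarith)
  exact mem_iInter.1 h j

theorem monotone_cantorMap (hab : ∀ j, a j < b j) (hba : ∀ j, b j < a (j + 1))
    (hP : ∀ j q, dyadicCell (b j) (P j q) ⊆ dyadicCell (a j) q) :
    Monotone (cantorMap a b P Q) := by
  intro x y hxy
  refine ciSup_le fun j => le_trans ?_ (cantorMap_mem hba hP y j).1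
  gcongr
  exact (strictMono_cantorIndex hab hP j).monotone (Int.floor_mono (by gcongr))

/-- The 2 adds two losses of 1: the floors, and the width of a cell of level `a j`. -/
theorem sub_le_of_cantorMap (hab : ∀ j, a j < b j) (hba : ∀ j, b j < a (j + 1))
    (hP : ∀ j q, dyadicCell (b j) (P j q) ⊆ dyadicCell (a j) q) {x y : ℝ} (hxy : x ≤ y) (j : ℕ) :
    y - x ≤ (2 ^ copiedDigits a b j)⁻¹ *
      (2 + (cantorMap a b P Q y - cantorMap a b P Q x) * 2 ^ a j) := by
  have hM : (0 : ℝ) < 2 ^ copiedDigits a b j := by positivity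
  have ha : (0 : ℝ) < 2 ^ a j := by positivity
  have h1 := (cantorMap_mem (Q := Q) hba hP y j).1
  have h2 := (cantorMap_mem (Q := Q) hba hP x j).2
  rw [div_le_iff₀ ha] at h1
  rw [le_div_iff₀ ha] at h2
  have h3 : ⌊x * 2 ^ copiedDigits a b j⌋ ≤ ⌊y * 2 ^ copiedDigits a b j⌋ :=
    Int.floor_mono (by gcongr)
  have h4 := sub_le_cantorIndex_sub (Q := Q) hab hP j h3
  have h4' : ((⌊y * 2 ^ copiedDigits a b j⌋ : ℝ) - ⌊x * 2 ^ copiedDigits a b j⌋) ≤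
    cantorIndex a b P Q j ⌊y * 2 ^ copiedDigits a b j⌋ -
      cantorIndex a b P Q j ⌊x * 2 ^ copiedDigits a b j⌋ := by exact_mod_cast h4
  have h5 := Int.floor_le (x * 2 ^ copiedDigits a b j)
  have h6 := Int.lt_floor_add_one (y * 2 ^ copiedDigits a b j)
  rw [inv_mul_eq_div, le_div_iff₀ hM]
  linarith

/-- This bound turns a cover of the Cantor set into a cover of `[0, 1)` whose diameters are at most
the gauge values, so Lebesgue measure bounds the gauge measure below. -/
theorem edist_le_cantorGauge (hab : ∀ j, a j < b j) (hba : ∀ j, b j < a (j + 1))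
    (hP : ∀ j q, dyadicCell (b j) (P j q) ⊆ dyadicCell (a j) q) (x y : ℝ) :
    edist x y ≤ cantorGauge a b (nndist (cantorMap a b P Q x) (cantorMap a b P Q y)) := by
  wlog hxy : x ≤ y generalizing x y
  · rw [edist_comm, nndist_comm]
    exact this y x (le_of_not_ge hxy)
  rw [edist_nndist, ENNReal.coe_le_coe]
  refine le_ciInf fun j => ?_
  rw [← NNReal.coe_le_coe, coe_nndist, Real.dist_eq, abs_sub_comm, abs_of_nonneg (by linarith)]
  push_cast
  rw [Real.dist_eq, abs_sub_comm,
    abs_of_nonneg (sub_nonneg.2 (monotone_cantorMap hab hba hP hxy))]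
  exact sub_le_of_cantorMap hab hba hP hxy j

theorem one_le_gaugeHausdorff_cantorMap (hab : ∀ j, a j < b j) (hba : ∀ j, b j < a (j + 1))
    (hP : ∀ j q, dyadicCell (b j) (P j q) ⊆ dyadicCell (a j) q) :
    1 ≤ gaugeHausdorff (cantorGauge a b) (cantorMap a b P Q '' Ico 0 1) := by
  refine le_iSup₂_of_le 1 one_pos (le_iInf fun U => le_iInf fun hK => le_iInf fun hU => ?_)
  have hcov : Ico (0 : ℝ) 1 ⊆ ⋃ i, cantorMap a b P Q ⁻¹' U i := by
    rw [← preimage_iUnion]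
    exact image_subset_iff.1 hK
  calc (1 : ℝ≥0∞) = volume (Ico (0 : ℝ) 1) := by simp
    _ ≤ ∑' i, volume (cantorMap a b P Q ⁻¹' U i) :=
        (measure_mono hcov).trans (measure_iUnion_le _)
    _ ≤ _ := ENNReal.tsum_le_tsum fun i => (Real.volume_le_diam _).trans <|
        Metric.ediam_le fun x hx y hy => (edist_le_cantorGauge (Q := Q) hab hba hP x y).trans ?_
  refine ENNReal.coe_le_coe.2 ((isGauge_cantorGauge a b).mono ?_)
  rw [← ENNReal.coe_le_coe, ENNReal.coe_toNNReal (hU i).ne_top, ← edist_nndist]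
  exact Metric.edist_le_ediam_of_mem hx hy

/-- The `2 ^ M j` chosen cells of level `b j` form a cover, and each has gauge at most `3 * 2 ^ (-M
j)`. -/
theorem gaugeHausdorff_cantorMap_le (hab : ∀ j, a j < b j) (hba : ∀ j, b j < a (j + 1))
    (hP : ∀ j q, dyadicCell (b j) (P j q) ⊆ dyadicCell (a j) q) :
    gaugeHausdorff (cantorGauge a b) (cantorMap a b P Q '' Ico 0 1) ≤ 3 := by
  classical
  refine iSup₂_le fun δ hδ => ?_
  have hb : ∀ j, j ≤ b j := by
    intro j
    induction j with
    | zero => exact Nat.zero_le _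
    | succ j ih =>
      have := hba j
      have := hab (j + 1)
      omega
  obtain ⟨j, hj⟩ : ∃ j, (((2 ^ b j)⁻¹ : ℝ≥0) : ℝ≥0∞) < δ := by
    obtain ⟨j, hj⟩ := ENNReal.exists_inv_two_pow_lt hδ.ne'
    refine ⟨j, lt_of_le_of_lt ?_ hj⟩
    rw [← ENNReal.inv_pow, ENNReal.coe_inv (by positivity)]
    push_cast
    gcongr
    · norm_num
    · exact hb j
  let n := 2 ^ copiedDigits a b j
  let U : ℕ → Set ℝ := fun i =>
    if i < n then dyadicCell (b j) (P j (cantorIndex a b P Q j i)) else ∅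
  have hU : ∀ i, Metric.ediam (U i) < δ := by
    intro i
    by_cases h : i < n
    · simpa only [U, h, if_true, ediam_dyadicCell] using hj
    · simpa [U, h] using hδ
  refine (gaugePre_le_tsum U ?_ hU).trans ?_
  · rintro _ ⟨x, hx, rfl⟩
    have h0 : 0 ≤ ⌊x * 2 ^ copiedDigits a b j⌋ := Int.floor_nonneg.2 (mul_nonneg hx.1 (by positivity))
    obtain ⟨i, hi⟩ := Int.eq_ofNat_of_zero_le h0
    have hin : i < n := by
      have : ⌊x * 2 ^ copiedDigits a b j⌋ < 2 ^ copiedDigits a b j := by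
        rw [Int.floor_lt]
        push_cast
        have := hx.2
        have hM : (0 : ℝ) < 2 ^ copiedDigits a b j := by positivity
        nlinarith
      rw [hi] at this
      exact_mod_cast this
    refine mem_iUnion.2 ⟨i, ?_⟩
    simp only [U, hin, if_true]
    have h := cantorIndex_succ_subset (P := P) (Q := Q) hba j x
      (cantorMap_mem hba hP x (j + 1))
    rwa [hi] at h
  · rw [tsum_eq_sum (s := Finset.range n)]
    · have h3 : ∀ i ∈ Finset.range n, (cantorGauge a b (Metric.ediam (U i)).toNNReal : ℝ≥0∞) =
          cantorGauge a b (2 ^ b j)⁻¹ := by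
        intro i hi
        simp only [U, Finset.mem_range.1 hi, if_true, ediam_dyadicCell, ENNReal.toNNReal_coe]
      rw [Finset.sum_congr rfl h3, Finset.sum_const, Finset.card_range, nsmul_eq_mul]
      have h4 : (n : ℝ≥0) * cantorGauge a b (2 ^ b j)⁻¹ ≤ 3 := by
        have h5 : (2 ^ b j)⁻¹ * 2 ^ a j ≤ (1 : ℝ≥0) := by
          rw [inv_mul_le_iff₀ (by positivity), mul_one]
          exact pow_le_pow_right₀ (by norm_num) (hab j).le
        calc (n : ℝ≥0) * cantorGauge a b (2 ^ b j)⁻¹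
            ≤ n * ((2 ^ copiedDigits a b j)⁻¹ * (2 + (2 ^ b j)⁻¹ * 2 ^ a j)) := by
              gcongr
              exact cantorGauge_le j _
          _ = 2 + (2 ^ b j)⁻¹ * 2 ^ a j := by
              simp only [n]
              push_cast
              field_simp
          _ ≤ 2 + 1 := by gcongr
          _ = 3 := by norm_num
      exact_mod_cast h4
    · intro i hi
      have : ¬ i < n := by simpa using hi
      simp [U, this, cantorGauge_zero hba]

end Cantor

/-- A Cantor set of measure one inside a set given by level-wise conditions, for a gauge that is at
most linear with a prescribed factor on prescribed ranges. -/
theorem exists_isGauge_measurableSet_eq_one {a b : ℕ → ℕ} (hab : ∀ j, a j < b j)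
    (hba : ∀ j, b j < a (j + 1)) {O : ℕ → Set ℝ} {J : Set ℝ}
    (hO : ∀ j q, ∃ p, dyadicCell (b j) p ⊆ dyadicCell (a j) q ∧
      (dyadicCell (a j) q ⊆ J → dyadicCell (b j) p ⊆ O j))
    {Q : ℤ} (hQ : dyadicCell (a 0) Q ⊆ J) :
    ∃ (g : ℝ≥0 → ℝ≥0) (K : Set ℝ) (D : ℝ≥0), IsGauge g ∧ g 0 = 0 ∧ MeasurableSet K ∧
      K ⊆ dyadicCell (a 0) Q ∧ (∀ j, K ⊆ O j) ∧ gaugeHausdorff g K = 1 ∧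
      ∀ j r, (2 ^ a (j + 1))⁻¹ ≤ r → g r ≤ D * r * 2 ^ b j := by
  choose P hP hPO using hO
  set K := cantorMap a b P Q '' Ico 0 1 with hK
  have hmem0 : ∀ x ∈ Ico (0 : ℝ) 1, ∀ j,
      dyadicCell (a j) (cantorIndex a b P Q j ⌊x * 2 ^ copiedDigits a b j⌋) ⊆
        dyadicCell (a 0) Q := by
    intro x hx j
    have h := antitone_cantorCell (Q := Q) hba hP x (Nat.zero_le j)
    have h0 : ⌊x⌋ = 0 := Int.floor_eq_zero_iff.2 hx
    simpa [copiedDigits, cantorIndex, h0] using h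
  have hinj : Function.Injective (cantorMap a b P Q) := by
    intro x y hxy
    have h := edist_le_cantorGauge (Q := Q) hab hba hP x y
    rw [hxy, nndist_self, cantorGauge_zero hba, ENNReal.coe_zero, nonpos_iff_eq_zero] at h
    exact edist_eq_zero.1 h
  have h1 : 1 ≤ gaugeHausdorff (cantorGauge a b) K := one_le_gaugeHausdorff_cantorMap hab hba hP
  have h3 : gaugeHausdorff (cantorGauge a b) K ≤ 3 := gaugeHausdorff_cantorMap_le hab hba hP
  set H := gaugeHausdorff (cantorGauge a b) K with hH
  have hH0 : H ≠ 0 := (one_pos.trans_le h1).ne'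
  have hHt : H ≠ ∞ := (h3.trans_lt (by simp)).ne
  have hc : (H.toNNReal)⁻¹ ≠ 0 := inv_ne_zero (ENNReal.toNNReal_ne_zero.2 ⟨hH0, hHt⟩)
  refine ⟨fun r => (H.toNNReal)⁻¹ * cantorGauge a b r, K, (H.toNNReal)⁻¹ * 3,
    (isGauge_cantorGauge a b).const_mul _, by simp [cantorGauge_zero hba],
    measurableSet_Ico.image_of_measurable_injOn (monotone_cantorMap hab hba hP).measurable
      hinj.injOn, ?_, ?_, ?_, ?_⟩
  · rintro _ ⟨x, hx, rfl⟩
    exact hmem0 x hx 0 (cantorMap_mem hba hP x 0)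
  · rintro j _ ⟨x, hx, rfl⟩
    exact hPO j _ ((hmem0 x hx j).trans hQ)
      (cantorIndex_succ_subset hba j x (cantorMap_mem hba hP x (j + 1)))
  · rw [gaugeHausdorff_const_mul _ hc, ← hH, ENNReal.coe_inv (by simpa using hc),
      ENNReal.coe_toNNReal hHt, ENNReal.inv_mul_cancel hH0 hHt]
  · intro j r hr
    calc (H.toNNReal)⁻¹ * cantorGauge a b r ≤ (H.toNNReal)⁻¹ * (3 * r * 2 ^ b j) := by
          gcongr
          exact cantorGauge_le_linear hba j hr
      _ = _ := by ring

/-- A nonmeagre analytic set of reals contains the trace on a nondegenerate interval of a countable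
intersection of dense open sets. -/
theorem MeasureTheory.AnalyticSet.exists_Icc_inter_subset {B : Set ℝ} (hB : AnalyticSet B)
    (hB2 : ¬ IsMeagre B) :
    ∃ (u v : ℝ) (O : ℕ → Set ℝ), u < v ∧ (∀ j, IsOpen (O j)) ∧ (∀ j, Dense (O j)) ∧
      Icc u v ∩ ⋂ j, O j ⊆ B := by
  obtain ⟨V, hVo, ⟨x, hx⟩, hV⟩ := hB.exists_isMeagre_diff hB2
  obtain ⟨ε, hε, hball⟩ := Metric.nhds_basis_closedBall.mem_iff.1 (hVo.mem_nhds hx)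
  rw [Real.closedBall_eq_Icc] at hball
  obtain ⟨S, hSo, hSd, hSc, hS⟩ := mem_residual_iff.1 hV
  -- Inserting `univ` makes the family nonempty, hence the range of a sequence.
  obtain ⟨O, hO⟩ := (hSc.insert univ).exists_eq_range (insert_nonempty _ _)
  have hmem : ∀ j, O j = univ ∨ O j ∈ S := fun j => by
    have : O j ∈ insert univ S := hO ▸ mem_range_self j
    exact this
  refine ⟨x - ε, x + ε, O, by linarith, fun j => ?_, fun j => ?_, ?_⟩
  · rcases hmem j with h | h
    · rw [h]; exact isOpen_univ
    · exact hSo _ h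
  · rcases hmem j with h | h
    · rw [h]; exact dense_univ
    · exact hSd _ h
  · rintro y ⟨hy, hyO⟩
    have hyS : y ∈ ⋂₀ S := fun t ht => by
      obtain ⟨j, rfl⟩ : t ∈ range O := hO ▸ mem_insert_of_mem _ ht
      exact mem_iInter.1 hyO j
    by_contra hyB
    exact hS hyS ⟨hball hy, hyB⟩

/-! ### Interleaved levels and blocks of indices. -/

/-- Interleaved choice of levels `a k < b k < a (k + 1)` and of positions `n k` in a
sequence. -/
theorem exists_levels {ρ : ℕ → ℝ≥0} (hρ0 : ∀ i, 0 < ρ i)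
    (R : ℕ → ℕ → ℕ → Prop) (hR : ∀ k a, ∃ b > a, R k a b) (a₀ : ℕ) :
    ∃ a b n : ℕ → ℕ, (∀ k, a₀ ≤ a k) ∧ (∀ k, a k < b k) ∧ (∀ k, b k < a (k + 1)) ∧
      StrictMono n ∧ (∀ k, R k (a k) (b k)) ∧ (∀ k, ∀ i < n k, (2 ^ a k)⁻¹ ≤ ρ i) ∧
      ∀ k, 2 ^ b k * ∑' i, ρ (i + n (k + 1)) ≤ (1 / 2) ^ k := by
  have h1 : ∀ n c : ℕ, ∃ a > c, ∀ i < n, (2 ^ a)⁻¹ ≤ ρ i := by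
    intro n c
    have hev : ∀ᶠ a : ℕ in atTop, ∀ i ∈ Finset.range n, (2 ^ a)⁻¹ ≤ ρ i := by
      refine (Finset.eventually_all _).2 fun i _ => ?_
      have ht : Tendsto (fun a : ℕ => (1 / 2 : ℝ≥0) ^ a) atTop (𝓝 0) :=
        tendsto_pow_atTop_nhds_zero_of_lt_one (by norm_num) (NNReal.half_lt_self one_ne_zero)
      filter_upwards [ht.eventually_lt_const (hρ0 i)] with a ha
      simpa using ha.le
    obtain ⟨a, ha, hac⟩ := (hev.and (eventually_gt_atTop c)).exists
    exact ⟨a, hac, fun i hi => ha i (Finset.mem_range.2 hi)⟩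
  have h2 : ∀ k b n : ℕ, ∃ n' > n, 2 ^ b * ∑' i, ρ (i + n') ≤ (1 / 2) ^ k := by
    intro k b n
    have ht := (NNReal.tendsto_sum_nat_add ρ).const_mul (2 ^ b)
    rw [mul_zero] at ht
    have hpos : (0 : ℝ≥0) < (1 / 2) ^ k := by positivity
    obtain ⟨n', h, hn'⟩ := ((ht.eventually_lt_const hpos).and (eventually_gt_atTop n)).exists
    exact ⟨n', hn', h.le⟩
  choose fa hfa hfa' using h1
  choose fb hfb hfb' using hR
  choose fn hfn hfn' using h2
  -- The state is `(n k, b (k - 1))`, with `a₀` standing in for the missing level.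
  let s : ℕ → ℕ × ℕ := fun k => Nat.rec (0, a₀)
    (fun k s => (fn k (fb k (fa s.1 s.2)) s.1, fb k (fa s.1 s.2))) k
  have hs : ∀ k, s (k + 1) = (fn k (fb k (fa (s k).1 (s k).2)) (s k).1,
    fb k (fa (s k).1 (s k).2)) := fun k => rfl
  have hab : ∀ k, fa (s k).1 (s k).2 < fb k (fa (s k).1 (s k).2) := fun k => hfb _ _
  have hba : ∀ k, fb k (fa (s k).1 (s k).2) < fa (s (k + 1)).1 (s (k + 1)).2 := fun k =>
    hfa (s (k + 1)).1 (s (k + 1)).2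
  refine ⟨fun k => fa (s k).1 (s k).2, fun k => fb k (fa (s k).1 (s k).2), fun k => (s k).1,
    fun k => ?_, hab, hba, strictMono_nat_of_lt_succ fun k => hfn _ _ _, fun k => hfb' _ _,
    fun k => hfa' _ _, fun k => hfn' _ _ _⟩
  induction k with
  | zero => exact (hfa 0 a₀).le
  | succ k ih => exact ih.trans ((hab k).trans (hba k)).le

/-- The indices lying in blocks `[n (2 j + e + 1), n (2 j + e + 2))`. -/
def alternateBlocks (n : ℕ → ℕ) (e : ℕ) : Set ℕ :=
  ⋃ j, Ico (n (2 * j + e + 1)) (n (2 * j + e + 2))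

theorem mem_alternateBlocks_or {n : ℕ → ℕ} (hn : StrictMono n) {i : ℕ} (hi : n 1 ≤ i) :
    i ∈ alternateBlocks n 0 ∨ i ∈ alternateBlocks n 1 := by
  have hex : ∃ k, i < n k := ⟨i + 1, (Nat.lt_succ_self i).trans_le (hn.le_apply)⟩
  classical
  obtain ⟨k, hk⟩ : ∃ k, Nat.find hex = k + 2 := by
    refine ⟨Nat.find hex - 2, ?_⟩
    have h : ¬ Nat.find hex < 2 := fun h =>
      absurd ((Nat.find_spec hex).trans_le (hn.monotone (Nat.le_of_lt_succ h))) (not_lt.2 hi)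
    omega
  have h1 : i < n (k + 2) := hk ▸ Nat.find_spec hex
  have h2 : n (k + 1) ≤ i := not_lt.1 (Nat.find_min hex (by omega))
  rcases Nat.even_or_odd' k with ⟨j, rfl | rfl⟩
  · exact Or.inl (mem_iUnion.2 ⟨j, h2, h1⟩)
  · exact Or.inr (mem_iUnion.2 ⟨j, h2, h1⟩)

theorem tsum_alternateBlocks_ne_top {ρ : ℕ → ℝ≥0} (hρ : Summable ρ) {a b n : ℕ → ℕ}
    (ha : ∀ k, ∀ i < n k, (2 ^ a k)⁻¹ ≤ ρ i)
    (hn : ∀ k, 2 ^ b k * ∑' i, ρ (i + n (k + 1)) ≤ (1 / 2) ^ k) {g : ℝ≥0 → ℝ≥0} {D : ℝ≥0} {e : ℕ}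
    (hg : ∀ j r, (2 ^ a (2 * (j + 1) + e))⁻¹ ≤ r → g r ≤ D * r * 2 ^ b (2 * j + e)) :
    ∑' i, (alternateBlocks n e).indicator (fun i => (g (ρ i) : ℝ≥0∞)) i ≠ ∞ := by
  classical
  have hblock : ∀ j, ∑' i, (Ico (n (2 * j + e + 1)) (n (2 * j + e + 2))).indicator
      (fun i => (g (ρ i) : ℝ≥0∞)) i ≤ ((D * (1 / 2) ^ j : ℝ≥0) : ℝ≥0∞) := by
    intro j
    calc _ ≤ ∑' i, (Ici (n (2 * j + e + 1))).indicator
          (fun i => ((D * 2 ^ b (2 * j + e) * ρ i : ℝ≥0) : ℝ≥0∞)) i := by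
          refine ENNReal.tsum_le_tsum fun i => ?_
          by_cases hi : i ∈ Ico (n (2 * j + e + 1)) (n (2 * j + e + 2))
          · rw [indicator_of_mem hi, indicator_of_mem (show i ∈ Ici _ from hi.1)]
            refine ENNReal.coe_le_coe.2 ((hg j _ (ha _ i ?_)).trans_eq (by ring))
            -- The block ends where the `ρ i` may drop below `2 ^ (-a (2 * (j + 1) + e))`, the lower
            -- end of the linear range.
            rw [show 2 * (j + 1) + e = 2 * j + e + 2 by ring]
            exact hi.2
          · rw [indicator_of_notMem hi]
            exact zero_le
      _ = ∑' i, ((D * 2 ^ b (2 * j + e) * ρ (i + n (2 * j + e + 1)) : ℝ≥0) : ℝ≥0∞) := by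
          rw [← Summable.sum_add_tsum_nat_add' (k := n (2 * j + e + 1)) ENNReal.summable,
            Finset.sum_eq_zero, zero_add]
          · exact tsum_congr fun i => indicator_of_mem (by simp) _
          · intro i hi
            exact indicator_of_notMem (by simpa using hi) _
      _ ≤ _ := by
          rw [← ENNReal.coe_tsum (((NNReal.summable_nat_add_iff _).2 hρ).mul_left _),
            ENNReal.coe_le_coe, tsum_mul_left, mul_assoc]
          gcongr
          refine (hn _).trans (pow_le_pow_of_le_one (by positivity) ?_ (by omega))
          exact (NNReal.half_lt_self one_ne_zero).le
  refine ne_top_of_le_ne_top (b := ∑' j : ℕ, ((D * (1 / 2) ^ j : ℝ≥0) : ℝ≥0∞)) ?_ ?_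
  · exact ENNReal.tsum_coe_ne_top_iff_summable.2
      ((NNReal.summable_geometric (NNReal.half_lt_self one_ne_zero)).mul_left D)
  · calc _ ≤ ∑' i, ∑' j, (Ico (n (2 * j + e + 1)) (n (2 * j + e + 2))).indicator
          (fun i => (g (ρ i) : ℝ≥0∞)) i := by
          refine ENNReal.tsum_le_tsum fun i => ?_
          by_cases hi : i ∈ alternateBlocks n e
          · obtain ⟨j, hj⟩ := mem_iUnion.1 hi
            refine le_trans ?_ (ENNReal.le_tsum j)
            rw [indicator_of_mem hi, indicator_of_mem hj]
          · rw [indicator_of_notMem hi]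
            exact zero_le
      _ = _ := ENNReal.tsum_comm
      _ ≤ _ := ENNReal.tsum_le_tsum hblock

/-! ### The two gauges and the decomposition. -/

/-- Two gauges, each charging a Cantor set inside a given nonmeagre analytic set with mass one, such
that a given Lebesgue null set splits into a null set for the first and a null set for the
second. -/
theorem exists_two_gauges {N B : Set ℝ} (hN : volume N = 0) (hB : AnalyticSet B)
    (hB2 : ¬ IsMeagre B) :
    ∃ (g₁ g₂ : ℝ≥0 → ℝ≥0) (K₁ K₂ L : Set ℝ), IsGauge g₁ ∧ IsGauge g₂ ∧
      MeasurableSet K₁ ∧ MeasurableSet K₂ ∧ MeasurableSet L ∧ K₁ ⊆ B ∧ K₂ ⊆ B ∧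
      Disjoint K₁ K₂ ∧ gaugeHausdorff g₁ K₁ = 1 ∧ gaugeHausdorff g₂ K₂ = 1 ∧
      gaugeHausdorff g₁ (N ∩ L) = 0 ∧ gaugeHausdorff g₂ (N \ L) = 0 := by
  obtain ⟨E, ρ, hEc, hρ0, hρ, hE, hNE⟩ := exists_frequently_mem_of_volume_eq_zero hN
  obtain ⟨u, v, O, huv, hOo, hOd, hOB⟩ := hB.exists_Icc_inter_subset hB2
  -- The point `w` separates the two Cantor sets.
  obtain ⟨w, huw, hwv⟩ := exists_between huv
  obtain ⟨c₁, hc₁⟩ := exists_dyadicCell_subset isOpen_Ioo (nonempty_Ioo.2 huw)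
  obtain ⟨c₂, hc₂⟩ := exists_dyadicCell_subset isOpen_Ioo (nonempty_Ioo.2 hwv)
  -- Levels `2 * j` and `2 * j + 1` both use `O j`, so each Cantor set meets every density
  -- condition.
  obtain ⟨a, b, n, ha₀, hab, hba, hn, hR, ha, htail⟩ := exists_levels hρ0
    (fun k a b => ∀ q : ℤ, ∃ p : ℤ, dyadicCell b p ⊆ dyadicCell a q ∧
      (dyadicCell a q ⊆ Icc u v → dyadicCell b p ⊆ O (k / 2)))
    (fun k a => exists_level_dyadicCell_subset (hOo _) (hOd _) u v a) (max c₁ c₂)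
  have hba2 : ∀ k, b k < a (k + 2) := fun k => (hba k).trans ((hab _).trans (hba _))
  obtain ⟨Q₁, hQ₁⟩ := hc₁ (a 0) ((le_max_left _ _).trans (ha₀ 0))
  obtain ⟨Q₂, hQ₂⟩ := hc₂ (a 1) ((le_max_right _ _).trans (ha₀ 1))
  have hsub₁ : dyadicCell (a 0) Q₁ ⊆ Icc u v := fun x hx =>
    ⟨(hQ₁ hx).1.le, ((hQ₁ hx).2.trans hwv).le⟩
  have hsub₂ : dyadicCell (a 1) Q₂ ⊆ Icc u v := fun x hx =>
    ⟨(huw.trans (hQ₂ hx).1).le, (hQ₂ hx).2.le⟩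
  obtain ⟨g₁, K₁, D₁, hg₁, hg₁0, hK₁, hK₁Q, hK₁O, hK₁1, hlin₁⟩ :=
    exists_isGauge_measurableSet_eq_one (a := fun j => a (2 * j + 0)) (b := fun j => b (2 * j + 0))
      (O := O) (J := Icc u v) (Q := Q₁)
      (fun j => hab _) (fun j => hba2 _) (fun j q => by
        have h := hR (2 * j + 0) q
        rwa [show (2 * j + 0) / 2 = j by omega] at h) hsub₁
  obtain ⟨g₂, K₂, D₂, hg₂, hg₂0, hK₂, hK₂Q, hK₂O, hK₂1, hlin₂⟩ :=
    exists_isGauge_measurableSet_eq_one (a := fun j => a (2 * j + 1)) (b := fun j => b (2 * j + 1))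
      (O := O) (J := Icc u v) (Q := Q₂)
      (fun j => hab _) (fun j => hba2 _) (fun j q => by
        have h := hR (2 * j + 1) q
        rwa [show (2 * j + 1) / 2 = j by omega] at h) hsub₂
  have hρt : Tendsto ρ atTop (𝓝 0) := NNReal.tendsto_atTop_zero_of_summable hρ
  let L : Set ℝ := ⋂ m, ⋃ i ∈ alternateBlocks n 0 ∩ Ici m, E i
  have hL : ∀ x, x ∈ L ↔ ∃ᶠ i in atTop, i ∈ alternateBlocks n 0 ∧ x ∈ E i := by
    intro x
    simp only [L, mem_iInter, mem_iUnion, frequently_atTop, mem_inter_iff, mem_Ici, exists_prop]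
    exact forall_congr' fun m => exists_congr fun i => by tauto
  refine ⟨g₁, g₂, K₁, K₂, L, hg₁, hg₂, hK₁, hK₂, ?_, ?_, ?_, ?_, hK₁1, hK₂1, ?_, ?_⟩
  · exact MeasurableSet.iInter fun m => MeasurableSet.biUnion (to_countable _)
      fun i _ => (hEc i).measurableSet
  · exact fun x hx => hOB ⟨hsub₁ (hK₁Q hx), mem_iInter.2 fun j => hK₁O j hx⟩
  · exact fun x hx => hOB ⟨hsub₂ (hK₂Q hx), mem_iInter.2 fun j => hK₂O j hx⟩
  · exact disjoint_left.2 fun x h₁ h₂ => lt_asymm (hQ₁ (hK₁Q h₁)).2 (hQ₂ (hK₂Q h₂)).1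
  · exact gaugeHausdorff_eq_zero_of_frequently hg₁.mono hg₁0 hE hρt
      (tsum_alternateBlocks_ne_top hρ ha htail hlin₁) fun x hx => (hL x).1 hx.2
  · refine gaugeHausdorff_eq_zero_of_frequently hg₂.mono hg₂0 hE hρt
      (tsum_alternateBlocks_ne_top hρ ha htail hlin₂) fun x hx => ?_
    -- Off `L`, the infinitely many `E i` containing `x` come, up to finitely many, from the other
    -- blocks.
    have h₁ : ∀ᶠ i in atTop, ¬ (i ∈ alternateBlocks n 0 ∧ x ∈ E i) :=
      not_frequently.1 fun h => hx.2 ((hL x).2 h)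
    refine ((hNE x hx.1).and_eventually (h₁.and (eventually_ge_atTop (n 1)))).mono ?_
    rintro i ⟨hxi, hi, hni⟩
    exact ⟨(mem_alternateBlocks_or hn hni).resolve_left fun h => hi ⟨h, hxi⟩, hxi⟩

theorem theorem2p4 (C : Set ℝ → Prop)
    (hC : C = (fun S : Set ℝ => MeasurableSet S) ∨ C = (fun S : Set ℝ => AnalyticSet S))
    (A B : Set ℝ) (hA : C A) (hB : C B) (hA0 : volume A = 0) (hB0 : volume B = 0)
    (hB2 : ¬ IsMeagre B) :
    ∃ (B₁ B₂ A₁ A₂ : Set ℝ) (g₁ g₂ : ℝ≥0 → ℝ≥0),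
      C B₁ ∧ C B₂ ∧ C A₁ ∧ C A₂ ∧
      B = B₁ ∪ B₂ ∧ Disjoint B₁ B₂ ∧ A = A₁ ∪ A₂ ∧ Disjoint A₁ A₂ ∧
      IsGauge g₁ ∧ IsGauge g₂ ∧
      gaugeHausdorff g₁ B₁ = 1 ∧ gaugeHausdorff g₁ A₁ = 0 ∧
      gaugeHausdorff g₂ B₂ = 1 ∧ gaugeHausdorff g₂ A₂ = 0 := by
  have hCa : ∀ S, C S → AnalyticSet S := by
    rcases hC with rfl | rfl
    exacts [fun S hS => MeasurableSet.analyticSet hS, fun S hS => hS]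
  have hCm : ∀ S, MeasurableSet S → C S := by
    rcases hC with rfl | rfl
    exacts [fun S hS => hS, fun S hS => hS.analyticSet]
  have hCu : ∀ S T, C S → C T → C (S ∪ T) := by
    rcases hC with rfl | rfl
    · exact fun S T hS hT => MeasurableSet.union hS hT
    · intro S T hS hT
      rw [union_eq_iUnion]
      exact AnalyticSet.iUnion (Bool.forall_bool.2 ⟨hT, hS⟩)
  have hCi : ∀ S T, C S → C T → C (S ∩ T) := by
    rcases hC with rfl | rfl
    · exact fun S T hS hT => MeasurableSet.inter hS hT
    · intro S T hS hT
      rw [inter_eq_iInter]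
      exact AnalyticSet.iInter (Bool.forall_bool.2 ⟨hT, hS⟩)
  obtain ⟨g₁, g₂, K₁, K₂, L, hg₁, hg₂, hK₁, hK₂, hL, hK₁B, hK₂B, hK, hK₁1, hK₂1, hN₁, hN₂⟩ :=
    exists_two_gauges (measure_union_null hA0 hB0) (hCa B hB) hB2
  have hnull₁ : ∀ {S : Set ℝ}, S ⊆ (A ∪ B) ∩ L → gaugeHausdorff g₁ S = 0 := fun h =>
    nonpos_iff_eq_zero.1 ((gaugeHausdorff_mono g₁ h).trans_eq hN₁)
  have hnull₂ : ∀ {S : Set ℝ}, S ⊆ (A ∪ B) \ L → gaugeHausdorff g₂ S = 0 := fun h =>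
    nonpos_iff_eq_zero.1 ((gaugeHausdorff_mono g₂ h).trans_eq hN₂)
  -- Each part of `B` is a Cantor set of measure one plus a null remainder, from which the other
  -- Cantor set is removed.
  refine ⟨K₁ ∪ B ∩ (L \ K₂), K₂ ∪ B ∩ (Lᶜ \ K₁), A ∩ L, A ∩ Lᶜ, g₁, g₂,
    hCu _ _ (hCm _ hK₁) (hCi _ _ hB (hCm _ (hL.diff hK₂))),
    hCu _ _ (hCm _ hK₂) (hCi _ _ hB (hCm _ (hL.compl.diff hK₁))),
    hCi _ _ hA (hCm _ hL), hCi _ _ hA (hCm _ hL.compl), ?_, ?_, (inter_union_compl A L).symm,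
    ?_, hg₁, hg₂, ?_, ?_, ?_, ?_⟩
  · ext x
    have h₁ := @hK₁B x
    have h₂ := @hK₂B x
    simp only [mem_union, mem_inter_iff, Set.mem_sdiff, mem_compl_iff]
    tauto
  · rw [disjoint_left] at hK ⊢
    intro x
    have h := @hK x
    simp only [mem_union, mem_inter_iff, Set.mem_sdiff, mem_compl_iff]
    tauto
  · exact disjoint_compl_right.mono inter_subset_right inter_subset_right
  · rw [gaugeHausdorff_union_null, hK₁1]
    exact hnull₁ fun x hx => ⟨Or.inr hx.1, hx.2.1⟩
  · exact hnull₁ fun x hx => ⟨Or.inl hx.1, hx.2⟩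
  · rw [gaugeHausdorff_union_null, hK₂1]
    exact hnull₂ fun x hx => ⟨Or.inr hx.1, hx.2.1⟩
  · exact hnull₂ fun x hx => ⟨Or.inl hx.1, hx.2⟩
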